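/- **Conventions.** Formulas are formulas of first-order logic without equality; structures are nonempty; constants are $0$-ary functions. $\mathrm{Fun}(E)$ is the set of functions occurring in $E$, and $\mathrm{Pred}^{\pm}(F)$ is the set of all pairs $+p$, $-p$ such that the predicate $p$ occurs in $F$ with positive, respectively negative, polarity. A formula is *ground* if it is quantifier-free and has no free variables. For sentences $F, G$ with $F \models G$, a *Craig–Lyndon interpolant* for $F, G$ is a sentence $H$ with $F \models H$, $H \models G$, $\mathrm{Pred}^{\pm}(H) \subseteq \mathrm{Pred}^{\pm}(F)\cap \mathrm{Pred}^{\pm}(G)$ and $\mathrm{Fun}(H) \subseteq \mathrm{Fun}(F)\cap \mathrm{Fun}(G)$. An *interpolant lifting base* is a tuple $\langle F, G, \mathcal{F}, \mathcal{G}, H_{\mathrm{grd}}\rangle$ where $F, G$ are sentences, $\mathcal{F}, \mathcal{G}$ are disjoint finite sets of function symbols, and $H_{\mathrm{grd}}$ is a ground formula, such that $\mathrm{Fun}(F)\cap\mathcal{G} = \emptyset$, $\mathrm{Fun}(G)\cap\mathcal{F} = \emptyset$, and there exist quantifier-free formulas $F_{\mathrm{exp}}(\mathbf{u})$, $G_{\mathrm{exp}}(\mathbf{v})$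 with disjoint tuples $\mathbf{u}$, $\mathbf{v}$ of free variables and a ground substitution $\theta$ with domain $\mathbf{u}\cup\mathbf{v}$ such that 1. $F \models \exists \mathcal{F}\,\forall \mathbf{u}\, F_{\mathrm{exp}}(\mathbf{u})$ and $\forall \mathcal{G}\,\exists \mathbf{v}\, G_{\mathrm{exp}}(\mathbf{v}) \models G$ (with second-order quantification over the functions in $\mathcal{F}$, $\mathcal{G}$); 2. $\mathrm{Pred}^{\pm}(F_{\mathrm{exp}}) \subseteq \mathrm{Pred}^{\pm}(F)$ and $\mathrm{Pred}^{\pm}(G_{\mathrm{exp}}) \subseteq \mathrm{Pred}^{\pm}(G)$; 3. $\mathrm{Fun}(F_{\mathrm{exp}}) \subseteq (\mathrm{Fun}(F)\cap\mathrm{Fun}(G))\cup\mathcal{F}$ and $\mathrm{Fun}(G_{\mathrm{exp}}) \subseteq (\mathrm{Fun}(F)\cap\mathrm{Fun}(G))\cup\mathcal{G}$; 4. the functions in the range of $\theta$ belong to $\mathrm{Fun}(F_{\mathrm{exp}})\cup\mathrm{Fun}(G_{\mathrm{exp}})$, possibly with the exception of a single additional constant $c_0\in\mathcal{F}\cup\mathcal{G}$;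 5. $H_{\mathrm{grd}}$ is a Craig–Lyndon interpolant for $F_{\mathrm{exp}}(\mathbf{u})\theta$ and $G_{\mathrm{exp}}(\mathbf{v})\theta$. For a set $S$ of functions, an *$S$-term* is a term whose outermost symbol is in $S$; an occurrence of an $S$-term is *$S$-maximal* if it is not within an occurrence of another $S$-term. **Theorem (Interpolant Lifting).** Let $\langle F, G, \mathcal{F}, \mathcal{G}, H_{\mathrm{grd}}\rangle$ be an interpolant lifting base. Let $\{t_1,\dots,t_n\}$ ($t_i$ pairwise distinct) be the set of the $(\mathcal{F}\cup\mathcal{G})$-terms with an $(\mathcal{F}\cup\mathcal{G})$-maximal occurrence in $H_{\mathrm{grd}}$, ordered such that if $t_i$ is a strict subterm of $t_j$, then $i<j$. Let $v_1,\dots,v_n$ be distinct fresh variables, and let $H'$ be $H_{\mathrm{grd}}$ with every $(\mathcal{F}\cup\mathcal{G})$-maximal occurrence of each $t_i$ replaced by $v_i$. For $i\in\{1,\dots,n\}$ let $Q_i$ be $\exists$ if $t_i$ is an $\mathcal{F}$-term, and $\forall$ otherwise, that is, if $t_i$ is a $\mathcal{G}$-term. Then $$H = Q_1 v_1 \cdots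 Q_n v_n\; H'$$ is a Craig–Lyndon interpolant for $F, G$. -/

import Mathlib

universe u v

namespace InterpolantLifting

open FirstOrder FirstOrder.Language

section Expressions

variable {L : FirstOrder.Language.{u, v}} {α β : Type}

/-- A function symbol together with its arity; constants are the symbols of arity `0`. -/
abbrev FunSym (L : FirstOrder.Language.{u, v}) : Type u := Σ k, L.Functions k

/-- A predicate symbol together with its arity. -/
abbrev PredSym (L : FirstOrder.Language.{u, v}) : Type v := Σ k, L.Relations k

/-- A ground term. -/
abbrev GroundTerm (L : FirstOrder.Language.{u, v}) : Type u := L.Term Empty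

/-- The function symbols (including constants) that occur in a term. -/
def termFuns : L.Term α → Set (FunSym L)
  | .var _ => ∅
  | .func f ts => {⟨_, f⟩} ∪ ⋃ i, termFuns (ts i)

/-- The function symbols (including constants) that occur in a formula. -/
def funs : {n : ℕ} → L.BoundedFormula α n → Set (FunSym L)
  | _, .falsum => ∅
  | _, .equal s t => termFuns s ∪ termFuns t
  | _, .rel _ ts => ⋃ i, termFuns (ts i)
  | _, .imp φ ψ => funs φ ∪ funs ψ
  | _, .all φ => funs φ

/-- `preds true φ` is the set of predicates with a positive occurrence in `φ`, and `preds false φ`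
the set of those with a negative occurrence. The premise of an implication is an implicit negation;
`¬`, `∧`, `∨`, `↔` and `∃` are abbreviations through `⊥`, `→` and `∀` that respect polarities. -/
def preds : {n : ℕ} → Bool → L.BoundedFormula α n → Set (PredSym L)
  | _, _, .falsum => ∅
  | _, _, .equal _ _ => ∅
  | _, b, .rel R _ => {q | b = true ∧ q = ⟨_, R⟩}
  | _, b, .imp φ ψ => preds (!b) φ ∪ preds b ψ
  | _, b, .all φ => preds b φ

/-- The formula belongs to first-order logic without equality. -/
def EqFree : {n : ℕ} → L.BoundedFormula α n → Prop
  | _, .falsum => True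
  | _, .equal _ _ => False
  | _, .rel _ _ => True
  | _, .imp φ ψ => EqFree φ ∧ EqFree ψ
  | _, .all φ => EqFree φ

/-- `StrictSubterm s t`: the term `s` is a strict subterm of `t`. -/
inductive StrictSubterm : L.Term α → L.Term α → Prop
  | arg {k : ℕ} (f : L.Functions k) (ts : Fin k → L.Term α) (i : Fin k) :
      StrictSubterm (ts i) (.func f ts)
  | deeper {k : ℕ} (f : L.Functions k) (ts : Fin k → L.Term α) (i : Fin k) (s : L.Term α)
      (h : StrictSubterm s (ts i)) : StrictSubterm s (.func f ts)

/-- The term is an `S`-term: its outermost symbol is a function symbol in `S`. -/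
def IsTermOf (S : Set (FunSym L)) : L.Term α → Prop
  | .var _ => False
  | .func f _ => (⟨_, f⟩ : FunSym L) ∈ S

/-- `MaxOccursInTerm S s t`: the `S`-term `s` has an `S`-maximal occurrence in the term `t`, that
is, an occurrence that is not within an occurrence of another `S`-term. -/
inductive MaxOccursInTerm (S : Set (FunSym L)) (s : L.Term α) : L.Term α → Prop
  | here (h : IsTermOf S s) : MaxOccursInTerm S s s
  | arg {k : ℕ} (f : L.Functions k) (ts : Fin k → L.Term α) (i : Fin k)
      (hf : (⟨k, f⟩ : FunSym L) ∉ S) (h : MaxOccursInTerm S s (ts i)) :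
      MaxOccursInTerm S s (.func f ts)

/-- A ground term, considered as a term over an arbitrary set of variables. -/
def liftGround (t : GroundTerm L) : L.Term β := t.relabel Empty.elim

/-- The ground `S`-term `s` has an `S`-maximal occurrence in the formula. -/
def MaxOccursIn (S : Set (FunSym L)) (s : GroundTerm L) : {n : ℕ} → L.BoundedFormula α n → Prop
  | _, .falsum => False
  | _, .equal t₁ t₂ => MaxOccursInTerm S (liftGround s) t₁ ∨ MaxOccursInTerm S (liftGround s) t₂
  | _, .rel _ ts => ∃ i, MaxOccursInTerm S (liftGround s) (ts i)
  | _, .imp φ ψ => MaxOccursIn S s φ ∨ MaxOccursIn S s ψ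
  | _, .all φ => MaxOccursIn S s φ

open Classical in
/-- Replaces, in a term over the variables `α`, every `S`-maximal occurrence of a term `σ i` by the
variable `fresh i`; the variables `x : α` of the term are renamed to `old x`. -/
noncomputable def invSubstTerm (S : Set (FunSym L)) {n : ℕ} (σ : Fin n → L.Term α)
    (old : α → β) (fresh : Fin n → β) : L.Term α → L.Term β
  | .var x => .var (old x)
  | .func (l := k) f ts =>
    if (⟨k, f⟩ : FunSym L) ∈ S then
      if h : ∃ i, σ i = .func f ts then .var (fresh h.choose)
      else .func f fun i => (ts i).relabel old
    else .func f fun i => invSubstTerm S σ old fresh (ts i)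

/-- For an injective family `σ` of ground `S`-terms: the formula `φ` with all `S`-maximal
occurrences of `σ i` replaced by the fresh free variable `v i`, which is `Sum.inr i`. -/
noncomputable def invSubst (S : Set (FunSym L)) {n m : ℕ} (σ : Fin n → GroundTerm L)
    (φ : L.BoundedFormula α m) : L.BoundedFormula (α ⊕ Fin n) m :=
  φ.mapTermRel
    (fun _ => invSubstTerm S (fun i => liftGround (σ i)) (Sum.map Sum.inl id)
      (fun i => Sum.inl (Sum.inr i)))
    (fun _ => id) (fun _ => id)

open Classical in
/-- The quantifier prefix `Q 0 v 0 … Q (n - 1) v (n - 1)` in front of `φ`, with `Q 0` outermost;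
`Q i` is `∃` if `E i` holds, and `∀` otherwise. -/
noncomputable def prefixQuantifiers : {n : ℕ} → (E : Fin n → Prop) → L.BoundedFormula α n →
    L.Formula α
  | 0, _, φ => φ
  | n + 1, E, φ =>
    prefixQuantifiers (fun i : Fin n => E i.castSucc) (if E (Fin.last n) then φ.ex else φ.all)

/-- The lifted formula `Q 0 v 0 … Q (n - 1) v (n - 1)  H⟨σ⁻¹⟩` for the family
`σ = {v i ↦ t i}`, where `Q i` is `∃` if `t i` is an `SF`-term and `∀` otherwise. -/
noncomputable def liftedFormula (SF SG : Set (FunSym L)) {n : ℕ} (t : Fin n → GroundTerm L)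
    (H : L.Sentence) : L.Sentence :=
  prefixQuantifiers (fun i => IsTermOf SF (t i))
    (BoundedFormula.relabel (k := 0) (id : Empty ⊕ Fin n → Empty ⊕ Fin n)
      (invSubst (SF ∪ SG) t H))

end Expressions

section Semantics

variable {L : FirstOrder.Language.{u, v}}

/-- Entailment between sentences: every (nonempty) model of `F` is a model of `G`. -/
def Entails (F G : L.Sentence) : Prop := ({F} : L.Theory) ⊨ᵇ G

/-- Two structures on the same domain differ at most in the interpretation of the function symbols
in `S`. -/
structure AgreeOff (S : Set (FunSym L)) {M : Type*} (A B : L.Structure M) : Prop where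
  funs : ∀ (k : ℕ) (f : L.Functions k), (⟨k, f⟩ : FunSym L) ∉ S → A.funMap f = B.funMap f
  preds : ∀ (k : ℕ) (R : L.Relations k), A.RelMap R = B.RelMap R

/-- The second-order sentence `∃ S ∀ u φ(u)`, with quantification over the function symbols in `S`,
holds in the structure `A`. -/
def HoldsExAll (S : Set (FunSym L)) {m : ℕ} (φ : L.Formula (Fin m)) {M : Type*}
    (A : L.Structure M) : Prop :=
  ∃ B : L.Structure M, AgreeOff S A B ∧ ∀ u : Fin m → M, @Formula.Realize L M B (Fin m) φ u

/-- The second-order sentence `∀ S ∃ u φ(u)`, with quantification over the function symbols in `S`,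
holds in the structure `A`. -/
def HoldsAllEx (S : Set (FunSym L)) {m : ℕ} (φ : L.Formula (Fin m)) {M : Type*}
    (A : L.Structure M) : Prop :=
  ∀ B : L.Structure M, AgreeOff S A B → ∃ u : Fin m → M, @Formula.Realize L M B (Fin m) φ u

/-- `H` is a Craig-Lyndon interpolant for the sentences `F`, `G` of first-order logic without
equality. (Sentences have no free variables, so that there is no condition on these.) -/
structure IsCraigLyndonInterpolant (F G H : L.Sentence) : Prop where
  eqFree : EqFree H
  entails : Entails F G
  entails_left : Entails F H
  entails_right : Entails H G
  preds_subset : ∀ b : Bool, preds b H ⊆ preds b F ∩ preds b G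
  funs_subset : funs H ⊆ funs F ∩ funs G

/-- The formulas `Fexp(u)` and `Gexp(v)`, with disjoint tuples of variables `u` and `v` that are
indexed by `Fin m` and `Fin k`, and the ground substitution `θ` with domain `u ∪ v` witness that
`⟨F, G, symF, symG, Hgrd⟩` is an interpolant lifting base. -/
structure IsExpansion (F G : L.Sentence) (symF symG : Set (FunSym L)) (Hgrd : L.Sentence)
    {m k : ℕ} (Fexp : L.Formula (Fin m)) (Gexp : L.Formula (Fin k))
    (θ : Fin m ⊕ Fin k → GroundTerm L) : Prop where
  eqFree_left : EqFree Fexp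
  eqFree_right : EqFree Gexp
  isQF_left : BoundedFormula.IsQF Fexp
  isQF_right : BoundedFormula.IsQF Gexp
  sem_left : ∀ (M : Type (max u v)) [Nonempty M] (A : L.Structure M),
    M ⊨ F → HoldsExAll symF Fexp A
  sem_right : ∀ (M : Type (max u v)) [Nonempty M] (A : L.Structure M),
    HoldsAllEx symG Gexp A → M ⊨ G
  preds_left : ∀ b : Bool, preds b Fexp ⊆ preds b F
  preds_right : ∀ b : Bool, preds b Gexp ⊆ preds b G
  funs_left : funs Fexp ⊆ (funs F ∩ funs G) ∪ symF
  funs_right : funs Gexp ⊆ (funs F ∩ funs G) ∪ symG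
  /-- Beyond the functions of `Fexp` and `Gexp`, at most one further constant `c₀` from
  `symF ∪ symG` is allowed in the range of `θ`. -/
  funs_range : ∃ C : Set (FunSym L), C.Subsingleton ∧ (∀ c ∈ C, c.1 = 0 ∧ c ∈ symF ∪ symG) ∧
    ∀ x, termFuns (θ x) ⊆ funs Fexp ∪ funs Gexp ∪ C
  interpolant : IsCraigLyndonInterpolant (BoundedFormula.subst Fexp fun i => θ (Sum.inl i))
    (BoundedFormula.subst Gexp fun j => θ (Sum.inr j)) Hgrd

/-- `⟨F, G, symF, symG, Hgrd⟩` is an interpolant lifting base. -/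
structure IsInterpolantLiftingBase (F G : L.Sentence) (symF symG : Finset (FunSym L))
    (Hgrd : L.Sentence) : Prop where
  eqFree_left : EqFree F
  eqFree_right : EqFree G
  disjoint_syms : Disjoint symF symG
  /-- `Hgrd` is ground: a quantifier-free sentence. -/
  ground : BoundedFormula.IsQF Hgrd
  disjoint_left : Disjoint (funs F) (symG : Set (FunSym L))
  disjoint_right : Disjoint (funs G) (symF : Set (FunSym L))
  exists_expansion : ∃ (m k : ℕ) (Fexp : L.Formula (Fin m)) (Gexp : L.Formula (Fin k))
    (θ : Fin m ⊕ Fin k → GroundTerm L), IsExpansion F G symF symG Hgrd Fexp Gexp θ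

end Semantics

end InterpolantLifting

/-! The interpolant lifting theorem is proved by playing the quantifier prefix as a game.

Let `A` be a model of `F`, and expand it to a structure `B` that differs from `A` only on `symF` and
satisfies `∀ u Fexp(u)`. The universal player hands out values for the `symG`-terms `t i`, and the
existential player answers for a `symF`-term `t i` with its value in `B`, where the `symG`-terms
inside `t i` take the values handed out so far (`termEval`). This is a legitimate strategy
(`realize_prefixQuantifiers`), since the value of `t i` depends only on the values of its strict
subterms, which precede it in the prefix (`termEval_congr`). It wins: pull the relations of `B` back
along `termEval` to a structure on the terms (`herbrandStructure`). There `Fexp(u)θ` holds because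
`Fexp` contains no `symG`-symbol, so that its instance at `θ` in the term structure is an instance
in `B` (`realize_herbrand_iff`). Hence the ground interpolant holds in the term structure, which
says that the matrix of the lifted formula holds in `B` for the values played
(`realize_herbrand_iff_realize_invSubst`). The lifted formula contains no symbol of `symF`, and so
holds in `A`.

For the entailment of `G` the roles are exchanged: the values of `symG`-terms are computed, those of
`symF`-terms are given, and a computed strategy for the universal player yields a play on which the
matrix is true (`exists_realize_of_prefixQuantifiers`), hence an instance of `Gexp` in `B`.

A term such as `f(g(c))` may have a strict subterm `g(c)` that is not among the `t i`, and so is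
represented by no variable of the prefix. If its value is not computed, it is chosen arbitrarily:
the argument needs only that every `t i` evaluates to the value played for it. -/

namespace InterpolantLifting

open FirstOrder FirstOrder.Language

/-! ### Syntactic bookkeeping -/

section Syntactic

variable {L : FirstOrder.Language.{u, v}} {α β : Type}

theorem termFuns_relabel (g : α → β) (s : L.Term α) : termFuns (s.relabel g) = termFuns s := by
  induction s with
  | var => rfl
  | func f ts ih => simp [termFuns, Term.relabel, ih]

theorem termFuns_subst_subset (s : L.Term α) (g : α → L.Term β) :
    termFuns (s.subst g) ⊆ termFuns s ∪ ⋃ a, termFuns (g a) := by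
  induction s with
  | var a => exact (Set.subset_iUnion (fun a => termFuns (g a)) a).trans Set.subset_union_right
  | func f ts ih =>
    simp only [termFuns, Term.subst]
    refine Set.union_subset (Set.subset_union_left.trans Set.subset_union_left)
      (Set.iUnion_subset fun i => (ih i).trans (Set.union_subset_union_left _ ?_))
    exact (Set.subset_iUnion (fun i => termFuns (ts i)) i).trans Set.subset_union_right

theorem preds_castLE {m n : ℕ} (h : m ≤ n) (b : Bool) (φ : L.BoundedFormula α m) :
    preds b (φ.castLE h) = preds b φ := by
  induction φ generalizing n b with
  | falsum => rfl
  | equal => rfl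
  | rel => rfl
  | imp _ _ ih₁ ih₂ => simp [preds, BoundedFormula.castLE, ih₁, ih₂]
  | all _ ih => simp [preds, BoundedFormula.castLE, ih]

theorem eqFree_castLE {m n : ℕ} (h : m ≤ n) (φ : L.BoundedFormula α m) :
    EqFree (φ.castLE h) ↔ EqFree φ := by
  induction φ generalizing n with
  | falsum => rfl
  | equal => rfl
  | rel => rfl
  | imp _ _ ih₁ ih₂ => simp [EqFree, BoundedFormula.castLE, ih₁, ih₂]
  | all _ ih => simp [EqFree, BoundedFormula.castLE, ih]

theorem preds_mapTermRel {g : ℕ → ℕ} (ft : ∀ n, L.Term (α ⊕ Fin n) → L.Term (β ⊕ Fin (g n)))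
    (h : ∀ n, L.BoundedFormula β (g (n + 1)) → L.BoundedFormula β (g n + 1))
    (hh : ∀ n b φ, preds b (h n φ) = preds b φ) {n : ℕ} (b : Bool) (φ : L.BoundedFormula α n) :
    preds b (φ.mapTermRel ft (fun _ => id) h) = preds b φ := by
  induction φ generalizing b with
  | falsum => rfl
  | equal => rfl
  | rel => rfl
  | imp _ _ ih₁ ih₂ => simp [preds, BoundedFormula.mapTermRel, ih₁, ih₂]
  | all _ ih => simp [preds, BoundedFormula.mapTermRel, ih, hh]

theorem eqFree_mapTermRel {g : ℕ → ℕ} (ft : ∀ n, L.Term (α ⊕ Fin n) → L.Term (β ⊕ Fin (g n)))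
    (h : ∀ n, L.BoundedFormula β (g (n + 1)) → L.BoundedFormula β (g n + 1))
    (hh : ∀ n φ, EqFree (h n φ) ↔ EqFree φ) {n : ℕ} (φ : L.BoundedFormula α n) :
    EqFree (φ.mapTermRel ft (fun _ => id) h) ↔ EqFree φ := by
  induction φ with
  | falsum => rfl
  | equal => rfl
  | rel => rfl
  | imp _ _ ih₁ ih₂ => simp [EqFree, BoundedFormula.mapTermRel, ih₁, ih₂]
  | all _ ih => simp [EqFree, BoundedFormula.mapTermRel, ih, hh]

theorem preds_subst {n : ℕ} (b : Bool) (φ : L.BoundedFormula α n) (g : α → L.Term β) :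
    preds b (φ.subst g) = preds b φ :=
  preds_mapTermRel (fun _ r => r.subst (Sum.elim (Term.relabel Sum.inl ∘ g) (Term.var ∘ Sum.inr)))
    (fun _ => id) (fun _ _ _ => rfl) b φ

theorem funs_subst_subset {n : ℕ} (φ : L.BoundedFormula α n) (g : α → L.Term β) :
    funs (φ.subst g) ⊆ funs φ ∪ ⋃ a, termFuns (g a) := by
  have key : ∀ {k : ℕ} (s : L.Term (α ⊕ Fin k)),
      termFuns (s.subst (Sum.elim (Term.relabel Sum.inl ∘ g) (Term.var ∘ Sum.inr)) :
        L.Term (β ⊕ Fin k)) ⊆ termFuns s ∪ ⋃ a, termFuns (g a) := by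
    intro k s
    refine (termFuns_subst_subset s _).trans (Set.union_subset_union_right _ ?_)
    refine Set.iUnion_subset ?_
    rintro (a | a)
    · simpa [termFuns_relabel] using Set.subset_iUnion (fun a => termFuns (g a)) a
    · simp [termFuns]
  unfold BoundedFormula.subst
  induction φ with
  | falsum => simp [BoundedFormula.mapTermRel, funs]
  | equal s₁ s₂ =>
    have h₁ := key s₁
    have h₂ := key s₂
    simp only [BoundedFormula.mapTermRel, funs]
    grind
  | rel R ts =>
    simp only [BoundedFormula.mapTermRel, funs]
    exact Set.iUnion_subset fun i => (key (ts i)).trans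
      (Set.union_subset_union_left _ (Set.subset_iUnion (fun i => termFuns (ts i)) i))
  | imp _ _ ih₁ ih₂ =>
    simp only [BoundedFormula.mapTermRel, funs]
    grind
  | all _ ih => simpa only [BoundedFormula.mapTermRel, funs, id] using ih

theorem funs_relabel {m k : ℕ} (g : α → β ⊕ Fin m) (φ : L.BoundedFormula α k) :
    funs (φ.relabel g) = funs φ := by
  unfold BoundedFormula.relabel
  induction φ with
  | falsum => rfl
  | equal => simp [BoundedFormula.mapTermRel, funs, termFuns_relabel]
  | rel => simp [BoundedFormula.mapTermRel, funs, termFuns_relabel]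
  | imp _ _ ih₁ ih₂ => simp [BoundedFormula.mapTermRel, funs, ih₁, ih₂]
  | all _ ih => simp [BoundedFormula.mapTermRel, funs, ih]

theorem funs_prefixQuantifiers {n : ℕ} (E : Fin n → Prop) (φ : L.BoundedFormula α n) :
    funs (prefixQuantifiers E φ) = funs φ := by
  induction n with
  | zero => rfl
  | succ n ih =>
    rw [prefixQuantifiers, ih]
    split_ifs <;> simp [funs]

theorem preds_prefixQuantifiers {n : ℕ} (E : Fin n → Prop) (b : Bool) (φ : L.BoundedFormula α n) :
    preds b (prefixQuantifiers E φ) = preds b φ := by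
  induction n with
  | zero => rfl
  | succ n ih =>
    rw [prefixQuantifiers, ih]
    split_ifs <;> simp [preds]

theorem eqFree_prefixQuantifiers {n : ℕ} (E : Fin n → Prop) (φ : L.BoundedFormula α n) :
    EqFree (prefixQuantifiers E φ) ↔ EqFree φ := by
  induction n with
  | zero => rfl
  | succ n ih =>
    rw [prefixQuantifiers, ih]
    split_ifs <;> simp [EqFree]

theorem preds_invSubst (S : Set (FunSym L)) {n : ℕ} (t : Fin n → GroundTerm L) {m : ℕ} (b : Bool)
    (φ : L.BoundedFormula α m) : preds b (invSubst S t φ) = preds b φ := by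
  unfold invSubst
  exact preds_mapTermRel (g := id) _ (fun _ => id) (fun _ _ _ => rfl) b φ

theorem eqFree_invSubst (S : Set (FunSym L)) {n : ℕ} (t : Fin n → GroundTerm L) {m : ℕ}
    (φ : L.BoundedFormula α m) : EqFree (invSubst S t φ) ↔ EqFree φ := by
  unfold invSubst
  exact eqFree_mapTermRel (g := id) _ (fun _ => id) (fun _ _ => Iff.rfl) φ

theorem preds_liftedFormula (SF SG : Set (FunSym L)) {n : ℕ} (t : Fin n → GroundTerm L)
    (H : L.Sentence) (b : Bool) : preds b (liftedFormula SF SG t H) = preds b H := by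
  rw [liftedFormula, preds_prefixQuantifiers]
  exact (preds_mapTermRel _ _ (fun _ _ _ => preds_castLE _ _ _) b _).trans
    (preds_invSubst _ t b H)

theorem eqFree_liftedFormula (SF SG : Set (FunSym L)) {n : ℕ} (t : Fin n → GroundTerm L)
    (H : L.Sentence) : EqFree (liftedFormula SF SG t H) ↔ EqFree H := by
  rw [liftedFormula, eqFree_prefixQuantifiers]
  exact (eqFree_mapTermRel _ _ (fun _ _ => eqFree_castLE _ _) _).trans
    (eqFree_invSubst _ t H)

end Syntactic

/-! ### Ground terms and maximal occurrences -/

section Ground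

variable {L : FirstOrder.Language.{u, v}} {α : Type}

/-- A ground term as a term over variables of any universe, such as the elements of a structure. -/
abbrev groundTerm (β : Type*) (s : GroundTerm L) : L.Term β := s.relabel Empty.elim

theorem groundTerm_injective {β : Type*} : Function.Injective (groundTerm (L := L) β) := by
  intro s
  induction s with
  | var a => exact a.elim
  | func f ts ih =>
    rintro (a | ⟨f', ts'⟩) h
    · exact a.elim
    · simp only [groundTerm, Term.relabel, Term.func.injEq] at h
      obtain ⟨rfl, h₁, h₂⟩ := h
      obtain rfl := eq_of_heq h₁
      congr 1
      funext i
      exact ih i (congrFun (eq_of_heq h₂) i)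

theorem liftGround_surjective [IsEmpty α] :
    Function.Surjective (liftGround : GroundTerm L → L.Term α) := by
  intro s
  induction s with
  | var a => exact isEmptyElim a
  | func f ts ih =>
    choose g hg using ih
    exact ⟨.func f g, by simpa [liftGround, Term.relabel] using funext hg⟩

theorem liftGround_subst {β : Type*} (s : GroundTerm L) (w : α → L.Term β) :
    (liftGround s : L.Term α).subst w = groundTerm β s := by
  unfold liftGround
  induction s with
  | var a => exact a.elim
  | func f ts ih => simpa [groundTerm, Term.relabel, Term.subst] using funext ih

theorem isTermOf_liftGround {S : Set (FunSym L)} (s : GroundTerm L) :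
    IsTermOf S (liftGround s : L.Term α) ↔ IsTermOf S s := by
  cases s with
  | var a => exact a.elim
  | func f ts => rfl

theorem isTermOf_union {S T : Set (FunSym L)} {s : L.Term α} :
    IsTermOf (S ∪ T) s ↔ IsTermOf S s ∨ IsTermOf T s := by
  cases s with
  | var => simp [IsTermOf]
  | func => rfl

theorem IsTermOf.not_of_disjoint {S T : Set (FunSym L)} (hST : Disjoint S T) {s : L.Term α}
    (h : IsTermOf S s) : ¬IsTermOf T s := by
  cases s with
  | var => exact h.elim
  | func => exact Set.disjoint_left.1 hST h

theorem MaxOccursInTerm.isTermOf {S : Set (FunSym L)} {s r : L.Term α}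
    (h : MaxOccursInTerm S s r) : IsTermOf S s := by
  induction h with
  | here h => exact h
  | arg _ _ _ _ _ ih => exact ih

theorem MaxOccursIn.isTermOf {S : Set (FunSym L)} {s : GroundTerm L} {n : ℕ}
    {φ : L.BoundedFormula α n} (h : MaxOccursIn S s φ) : IsTermOf S s := by
  induction φ with
  | falsum => exact h.elim
  | equal => exact (isTermOf_liftGround s).1 (h.elim (·.isTermOf) (·.isTermOf))
  | rel =>
    obtain ⟨i, hi⟩ := h
    exact (isTermOf_liftGround s).1 hi.isTermOf
  | imp _ _ ih₁ ih₂ => exact h.elim ih₁ ih₂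
  | all _ ih => exact ih h

/-- An `S`-symbol heads only terms that are replaced as a whole, so that none survives the
replacement. -/
theorem termFuns_invSubstTerm_subset {β : Type} [IsEmpty α] {S : Set (FunSym L)} {n : ℕ}
    (t : Fin n → GroundTerm L) (old : α → β) (fresh : Fin n → β) (r : L.Term α)
    (h : ∀ s : GroundTerm L, MaxOccursInTerm S (liftGround s) r → s ∈ Set.range t) :
    termFuns (invSubstTerm S (fun i => liftGround (t i)) old fresh r) ⊆ termFuns r \ S := by
  induction r with
  | var a => exact isEmptyElim a
  | @func k f ts ih =>
    obtain ⟨s, hs⟩ := liftGround_surjective (L := L) (Term.func f ts)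
    rw [invSubstTerm]
    split_ifs with hf hex
    · simp [termFuns]
    · obtain ⟨i, rfl⟩ := h s (by rw [hs]; exact .here hf)
      exact absurd ⟨i, hs⟩ hex
    · simp only [termFuns]
      refine Set.union_subset (Set.singleton_subset_iff.2 ⟨Or.inl rfl, hf⟩)
        (Set.iUnion_subset fun i => (ih i fun s hs => h s (.arg f ts i hf hs)).trans ?_)
      exact Set.sdiff_subset_sdiff_left
        ((Set.subset_iUnion (fun i => termFuns (ts i)) i).trans Set.subset_union_right)

theorem funs_invSubst_subset {S : Set (FunSym L)} {n : ℕ} (t : Fin n → GroundTerm L)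
    {φ : L.Sentence} (hφ : BoundedFormula.IsQF φ)
    (h : ∀ s, MaxOccursIn S s φ → s ∈ Set.range t) : funs (invSubst S t φ) ⊆ funs φ \ S := by
  unfold invSubst
  induction hφ with
  | falsum => simp [BoundedFormula.mapTermRel, funs]
  | of_isAtomic hφ =>
    cases hφ with
    | equal s₁ s₂ =>
      have h₁ := termFuns_invSubstTerm_subset t (Sum.map Sum.inl id)
        (fun i => (Sum.inl (Sum.inr i) : (Empty ⊕ Fin n) ⊕ Fin 0)) s₁ fun s hs => h s (Or.inl hs)
      have h₂ := termFuns_invSubstTerm_subset t (Sum.map Sum.inl id)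
        (fun i => (Sum.inl (Sum.inr i) : (Empty ⊕ Fin n) ⊕ Fin 0)) s₂ fun s hs => h s (Or.inr hs)
      simp only [Term.bdEqual, BoundedFormula.mapTermRel, funs]
      grind
    | rel R ts =>
      simp only [Relations.boundedFormula, BoundedFormula.mapTermRel, funs]
      refine Set.iUnion_subset fun i =>
        (termFuns_invSubstTerm_subset t _ _ (ts i) fun s hs => h s ⟨i, hs⟩).trans ?_
      exact Set.sdiff_subset_sdiff_left (Set.subset_iUnion (fun i => termFuns (ts i)) i)
  | imp _ _ ih₁ ih₂ =>
    have h₁ := ih₁ fun s hs => h s (Or.inl hs)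
    have h₂ := ih₂ fun s hs => h s (Or.inr hs)
    simp only [BoundedFormula.mapTermRel, funs]
    grind

theorem funs_liftedFormula_subset {SF SG : Set (FunSym L)} {n : ℕ} (t : Fin n → GroundTerm L)
    {φ : L.Sentence} (hφ : BoundedFormula.IsQF φ)
    (h : ∀ s, MaxOccursIn (SF ∪ SG) s φ → s ∈ Set.range t) :
    funs (liftedFormula SF SG t φ) ⊆ funs φ \ (SF ∪ SG) := by
  rw [liftedFormula, funs_prefixQuantifiers]
  exact (funs_relabel (k := 0) _ _).subset.trans (funs_invSubst_subset t hφ h)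

end Ground

/-! ### Reinterpretation of symbols that do not occur -/

section Agree

variable {L : FirstOrder.Language.{u, v}} {M : Type*} {S : Set (FunSym L)} {A B : L.Structure M}

theorem AgreeOff.symm (h : AgreeOff S A B) : AgreeOff S B A :=
  ⟨fun k f hf => (h.funs k f hf).symm, fun k R => (h.preds k R).symm⟩

theorem AgreeOff.realize_iff {α : Type} {n : ℕ} (h : AgreeOff S A B) (φ : L.BoundedFormula α n)
    (hφ : Disjoint (InterpolantLifting.funs φ) S) (w : α → M) (xs : Fin n → M) :
    @BoundedFormula.Realize L M A α n φ w xs ↔ @BoundedFormula.Realize L M B α n φ w xs := by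
  have key : ∀ {k : ℕ} (s : L.Term (α ⊕ Fin k)), Disjoint (termFuns s) S → ∀ w : α ⊕ Fin k → M,
      @Term.realize L M A _ w s = @Term.realize L M B _ w s := by
    intro k s hs w
    induction s with
    | var => rfl
    | func f ts ih =>
      simp only [termFuns, Set.disjoint_union_left, Set.disjoint_singleton_left,
        Set.disjoint_iUnion_left] at hs
      simp only [Term.realize, h.funs _ f hs.1, fun i => ih i (hs.2 i)]
  induction φ with
  | falsum => rfl
  | equal s₁ s₂ =>
    simp only [InterpolantLifting.funs, Set.disjoint_union_left] at hφ
    simp only [BoundedFormula.Realize, key s₁ hφ.1, key s₂ hφ.2]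
  | rel R ts =>
    simp only [InterpolantLifting.funs, Set.disjoint_iUnion_left] at hφ
    simp only [BoundedFormula.Realize, h.preds, fun i => key (ts i) (hφ i)]
  | imp _ _ ih₁ ih₂ =>
    simp only [InterpolantLifting.funs, Set.disjoint_union_left] at hφ
    simp only [BoundedFormula.Realize, ih₁ hφ.1, ih₂ hφ.2]
  | all _ ih => simp only [BoundedFormula.Realize, ih hφ]

theorem Entails.realize {F G : L.Sentence} (h : Entails F G) (N : Type*) [L.Structure N]
    [Nonempty N] (hF : N ⊨ F) : N ⊨ G :=
  have : N ⊨ ({F} : L.Theory) := by simpa using hF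
  Theory.ModelsBoundedFormula.realize_sentence h N

theorem entails_of_forall {F G : L.Sentence}
    (h : ∀ (N : Type (max u v)) [Nonempty N] [L.Structure N], N ⊨ F → N ⊨ G) : Entails F G := by
  refine Theory.models_sentence_iff.2 fun N => h N ?_
  exact Theory.realize_sentence_of_mem {F} (Set.mem_singleton F)

end Agree

/-! ### Quantifier prefixes as games -/

section Prefix

variable {L : FirstOrder.Language.{u, v}} {α : Type} {M : Type*} [L.Structure M] [Nonempty M]

/-- If the existential player, by answering `c i` in the `i`-th move, always reaches a true matrix,
then the prefixed formula is true. -/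
theorem realize_prefixQuantifiers {n : ℕ} {E : Fin n → Prop} {φ : L.BoundedFormula α n} {w : α → M}
    (c : Fin n → (Fin n → M) → M)
    (hc : ∀ i, E i → ∀ xs ys : Fin n → M, (∀ j < i, xs j = ys j) → c i xs = c i ys)
    (h : ∀ xs : Fin n → M, (∀ i, E i → xs i = c i xs) → φ.Realize w xs) :
    (prefixQuantifiers E φ).Realize w := by
  induction n with
  | zero => exact h default fun i => i.elim0
  | succ n ih =>
    have hlocal : ∀ i, E i → ∀ (xs ys : Fin n → M) (a b : M),
        (∀ j : Fin n, j.castSucc < i → xs j = ys j) →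
        c i (Fin.snoc xs a : Fin (n + 1) → M) = c i (Fin.snoc ys b : Fin (n + 1) → M) := by
      refine fun i hi xs ys a b hxy => hc i hi _ _ fun j hj => ?_
      obtain ⟨j, rfl⟩ := Fin.exists_castSucc_eq.2 (hj.trans_le (Fin.le_last i)).ne
      simpa using hxy j hj
    refine ih (fun i xs => c i.castSucc (Fin.snoc xs (Classical.arbitrary M) : Fin (n + 1) → M))
      (fun i hi xs ys hxy => hlocal _ hi _ _ _ _ fun j hj => hxy j hj) fun xs hxs => ?_
    have hplay : ∀ a, (E (Fin.last n) →
        a = c (Fin.last n) (Fin.snoc xs a : Fin (n + 1) → M)) →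
        φ.Realize w (Fin.snoc xs a : Fin (n + 1) → M) := by
      refine fun a ha => h _ fun i => Fin.lastCases ?_ (fun i => ?_) i
      · simpa using ha
      · intro hi
        rw [Fin.snoc_castSucc, hxs i hi]
        exact hlocal _ hi _ _ _ _ fun _ _ => rfl
    split_ifs with hE
    · refine BoundedFormula.realize_ex.2
        ⟨c (Fin.last n) (Fin.snoc xs (Classical.arbitrary M) : Fin (n + 1) → M), hplay _ fun _ => ?_⟩
      exact hlocal _ hE _ _ _ _ fun _ _ => rfl
    · exact BoundedFormula.realize_all.2 fun a => hplay a fun hE' => absurd hE' hE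

/-- If the prefixed formula is true, then the universal player, by answering `c i` in the `i`-th
move, can be led to a true matrix. -/
theorem exists_realize_of_prefixQuantifiers {n : ℕ} {E : Fin n → Prop} {φ : L.BoundedFormula α n}
    {w : α → M} (c : Fin n → (Fin n → M) → M)
    (hc : ∀ i, ¬E i → ∀ xs ys : Fin n → M, (∀ j < i, xs j = ys j) → c i xs = c i ys)
    (h : (prefixQuantifiers E φ).Realize w) :
    ∃ xs : Fin n → M, (∀ i, ¬E i → xs i = c i xs) ∧ φ.Realize w xs := by
  induction n with
  | zero => exact ⟨default, fun i => i.elim0, h⟩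
  | succ n ih =>
    have hlocal : ∀ i, ¬E i → ∀ (xs ys : Fin n → M) (a b : M),
        (∀ j : Fin n, j.castSucc < i → xs j = ys j) →
        c i (Fin.snoc xs a : Fin (n + 1) → M) = c i (Fin.snoc ys b : Fin (n + 1) → M) := by
      refine fun i hi xs ys a b hxy => hc i hi _ _ fun j hj => ?_
      obtain ⟨j, rfl⟩ := Fin.exists_castSucc_eq.2 (hj.trans_le (Fin.le_last i)).ne
      simpa using hxy j hj
    obtain ⟨xs, hxs, hφ⟩ := ih
      (fun i xs => c i.castSucc (Fin.snoc xs (Classical.arbitrary M) : Fin (n + 1) → M))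
      (fun i hi xs ys hxy => hlocal _ hi _ _ _ _ fun j hj => hxy j hj) h
    obtain ⟨a, ha, hφa⟩ : ∃ a, (¬E (Fin.last n) →
        a = c (Fin.last n) (Fin.snoc xs a : Fin (n + 1) → M)) ∧
        φ.Realize w (Fin.snoc xs a : Fin (n + 1) → M) := by
      split_ifs at hφ with hE
      · obtain ⟨a, ha⟩ := BoundedFormula.realize_ex.1 hφ
        exact ⟨a, fun hE' => absurd hE hE', ha⟩
      · exact ⟨c (Fin.last n) (Fin.snoc xs (Classical.arbitrary M) : Fin (n + 1) → M),
          fun _ => hlocal _ hE _ _ _ _ fun _ _ => rfl, BoundedFormula.realize_all.1 hφ _⟩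
    refine ⟨(Fin.snoc xs a : Fin (n + 1) → M), fun i => Fin.lastCases ?_ (fun i => ?_) i, hφa⟩
    · simpa using ha
    · intro hi
      rw [Fin.snoc_castSucc, hxs i hi]
      exact hlocal _ hi _ _ _ _ fun _ _ => rfl

end Prefix

/-! ### Term evaluation with prescribed values, and the induced structure on terms -/

section Herbrand

variable {L : FirstOrder.Language.{u, v}}

/-- The structure on terms in which function symbols build terms, and relations are pulled back from
`M` along the evaluation `ev`. -/
@[reducible] def herbrandStructure {M : Type*} [L.Structure M] (ev : L.Term M → M) :
    L.Structure (L.Term M) where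
  funMap f ts := .func f ts
  RelMap R ts := Structure.RelMap R fun i => ev (ts i)

theorem realize_term_herbrand {M : Type*} [L.Structure M] {α : Type*} (ev : L.Term M → M) (s : L.Term α) (w : α → L.Term M) :
    @Term.realize L (L.Term M) (herbrandStructure ev) α w s = s.subst w := by
  induction s with
  | var => rfl
  | func f ts ih =>
    simp only [Term.realize, Term.subst, ih]
    rfl

variable {M : Type*} [L.Structure M] [Nonempty M]

open Classical in
/-- The value of a term in `M` when the `S`-term `t i` has the prescribed value `xs i`. `S`-terms
that are not among the `t i` get an arbitrary value; all other symbols are interpreted in `M`. The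
elements of `M` serve as variables in order that the set of terms is nonempty. -/
noncomputable def termEval (S : Set (FunSym L)) {n : ℕ} (t : Fin n → GroundTerm L)
    (xs : Fin n → M) : L.Term M → M
  | .var a => a
  | .func (l := k) f ts =>
    if (⟨k, f⟩ : FunSym L) ∈ S then
      if h : ∃ i, groundTerm M (t i) = .func f ts then xs h.choose else Classical.arbitrary M
    else Structure.funMap f fun i => termEval S t xs (ts i)

variable {S : Set (FunSym L)} {n : ℕ} {t : Fin n → GroundTerm L}

theorem termEval_of_isTermOf (ht : Function.Injective t) (xs : Fin n → M) {i : Fin n}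
    (hi : IsTermOf S (t i)) : termEval S t xs (groundTerm M (t i)) = xs i := by
  cases hti : t i with
  | var a => exact a.elim
  | func f ts =>
    rw [hti] at hi
    replace hi : (⟨_, f⟩ : FunSym L) ∈ S := hi
    have hex : ∃ j, groundTerm M (t j) = groundTerm M (.func f ts) := ⟨i, by rw [hti]⟩
    have hj : hex.choose = i := ht (groundTerm_injective (hex.choose_spec.trans (by rw [hti])))
    have : termEval S t xs (groundTerm M (.func f ts)) = xs hex.choose := by
      change termEval S t xs (.func f _) = _
      rw [termEval, if_pos hi]
      exact dif_pos hex
    rw [this, hj]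

theorem termEval_congr_of_subterm (s : GroundTerm L) (xs ys : Fin n → M)
    (h : ∀ j, t j = s ∨ StrictSubterm (t j) s → xs j = ys j) :
    termEval S t xs (groundTerm M s) = termEval S t ys (groundTerm M s) := by
  induction s with
  | var a => exact a.elim
  | func f ts ih =>
    change termEval S t xs (.func f _) = termEval S t ys (.func f _)
    rw [termEval, termEval]
    split_ifs with hf hex
    · exact h _ (Or.inl (groundTerm_injective hex.choose_spec))
    · rfl
    · congr 1
      funext i
      refine ih i fun j hj => h j (Or.inr ?_)
      rcases hj with hj | hj
      · exact hj ▸ .arg f ts i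
      · exact .deeper f ts i _ hj

/-- The value of a term `t i` that is not an `S`-term depends only on the values prescribed for
earlier terms. -/
theorem termEval_congr (ht_order : ∀ i j, StrictSubterm (t i) (t j) → i < j) {i : Fin n}
    (hi : ¬IsTermOf S (t i)) (xs ys : Fin n → M) (h : ∀ j < i, xs j = ys j) :
    termEval S t xs (groundTerm M (t i)) = termEval S t ys (groundTerm M (t i)) := by
  have hlt : ∀ j, StrictSubterm (t j) (t i) → xs j = ys j := fun j hj => h j (ht_order j i hj)
  cases hti : t i with
  | var a => exact a.elim
  | func f ts =>
    rw [hti] at hi hlt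
    replace hi : (⟨_, f⟩ : FunSym L) ∉ S := hi
    change termEval S t xs (.func f _) = termEval S t ys (.func f _)
    rw [termEval, termEval, if_neg hi, if_neg hi]
    congr 1
    funext k
    refine termEval_congr_of_subterm (ts k) xs ys fun j hj => hlt j ?_
    rcases hj with hj | hj
    · exact hj ▸ .arg f ts k
    · exact .deeper f ts k _ hj

theorem termEval_subst {α : Type} (xs : Fin n → M) (s : L.Term α) (hs : Disjoint (termFuns s) S)
    (w : α → L.Term M) :
    termEval S t xs (s.subst w) = s.realize fun a => termEval S t xs (w a) := by
  induction s with
  | var => rfl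
  | func f ts ih =>
    simp only [termFuns, Set.disjoint_union_left, Set.disjoint_singleton_left,
      Set.disjoint_iUnion_left] at hs
    simp only [Term.subst, termEval, if_neg hs.1, Term.realize, fun i => ih i (hs.2 i)]

/-- Formulas without symbols from `S` do not distinguish the term structure from `M`. Equality is
excluded because `termEval` is not injective. -/
theorem realize_herbrand_iff {α : Type} (xs : Fin n → M) {φ : L.Formula α}
    (hφ : BoundedFormula.IsQF φ) (heq : EqFree φ) (hS : Disjoint (funs φ) S) (w : α → L.Term M) :
    @Formula.Realize L (L.Term M) (herbrandStructure (termEval S t xs)) α φ w ↔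
      φ.Realize fun a => termEval S t xs (w a) := by
  unfold Formula.Realize
  induction hφ with
  | falsum => rfl
  | of_isAtomic hφ =>
    cases hφ with
    | equal => exact heq.elim
    | rel R ts =>
      simp only [Relations.boundedFormula, funs, Set.disjoint_iUnion_left] at hS
      simp only [Relations.boundedFormula, BoundedFormula.Realize, realize_term_herbrand]
      change Structure.RelMap R (fun i => termEval S t xs ((ts i).subst _)) ↔ _
      refine iff_of_eq (congrArg _ (funext fun i => (termEval_subst xs (ts i) (hS i) _).trans
        (congrArg (fun w => (ts i).realize w) ?_)))
      funext a
      rcases a with a | a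
      · rfl
      · exact a.elim0
  | imp _ _ ih₁ ih₂ =>
    simp only [funs, Set.disjoint_union_left] at hS
    simp only [BoundedFormula.Realize, ih₁ heq.1 hS.1, ih₂ heq.2 hS.2]

/-- If the values `xs` cohere with the evaluation, then evaluating a ground term is the same as
replacing its maximal `S'`-terms by variables and evaluating these to `xs`. -/
theorem termEval_eq_realize_invSubstTerm {α β : Type} [IsEmpty α] {S' : Set (FunSym L)}
    (hSS' : S ⊆ S') (xs : Fin n → M) (hxs : ∀ i, xs i = termEval S t xs (groundTerm M (t i)))
    (old : α → β) (fresh : Fin n → β) (w : α → L.Term M) (w' : β → M)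
    (hw' : ∀ i, w' (fresh i) = xs i) (r : L.Term α)
    (h : ∀ s : GroundTerm L, MaxOccursInTerm S' (liftGround s) r → s ∈ Set.range t) :
    termEval S t xs (r.subst w) =
      (invSubstTerm S' (fun i => liftGround (t i)) old fresh r).realize w' := by
  induction r with
  | var a => exact isEmptyElim a
  | @func k f ts ih =>
    obtain ⟨s, hs⟩ := liftGround_surjective (L := L) (Term.func f ts)
    rw [invSubstTerm]
    split_ifs with hf hex
    · rw [Term.realize, hw', hxs, ← liftGround_subst (t hex.choose) w]
      exact congrArg (fun r => termEval S t xs (r.subst w)) hex.choose_spec.symm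
    · obtain ⟨i, rfl⟩ := h s (by rw [hs]; exact .here hf)
      exact absurd ⟨i, hs⟩ hex
    · have hf' : (⟨k, f⟩ : FunSym L) ∉ S := fun hS => hf (hSS' hS)
      simp only [Term.subst, termEval, if_neg hf', Term.realize,
        fun i => ih i fun s hs => h s (.arg f ts i hf hs)]

/-- For coherent values `xs`, the ground formula holds in the term structure if and only if the
matrix of its lifting holds at `xs`. -/
theorem realize_herbrand_iff_realize_invSubst {S' : Set (FunSym L)} (hSS' : S ⊆ S')
    (xs : Fin n → M) (hxs : ∀ i, xs i = termEval S t xs (groundTerm M (t i))) {φ : L.Sentence}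
    (hφ : BoundedFormula.IsQF φ) (heq : EqFree φ)
    (h : ∀ s, MaxOccursIn S' s φ → s ∈ Set.range t) :
    @Sentence.Realize L (L.Term M) (herbrandStructure (termEval S t xs)) φ ↔
      (BoundedFormula.relabel (k := 0) (id : Empty ⊕ Fin n → Empty ⊕ Fin n)
        (invSubst S' t φ)).Realize default xs := by
  rw [BoundedFormula.realize_relabel]
  unfold Sentence.Realize Formula.Realize invSubst
  induction hφ with
  | falsum => rfl
  | of_isAtomic hφ =>
    cases hφ with
    | equal => exact heq.elim
    | rel R ts =>
      simp only [Relations.boundedFormula, BoundedFormula.mapTermRel, BoundedFormula.Realize,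
        realize_term_herbrand, id]
      change Structure.RelMap R (fun i => termEval S t xs ((ts i).subst _)) ↔ _
      refine iff_of_eq (congrArg _ (funext fun i => ?_))
      exact termEval_eq_realize_invSubstTerm hSS' xs hxs (Sum.map Sum.inl id)
        (fun i => Sum.inl (Sum.inr i)) _ (Sum.elim _ _) (fun _ => rfl) (ts i) fun s hs => h s ⟨i, hs⟩
  | imp _ _ ih₁ ih₂ =>
    simp only [BoundedFormula.mapTermRel, BoundedFormula.Realize,
      ih₁ heq.1 fun s hs => h s (Or.inl hs), ih₂ heq.2 fun s hs => h s (Or.inr hs)]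

end Herbrand

/-! ### The two entailments -/

section Lifting

variable {L : FirstOrder.Language.{u, v}} {SF SG : Set (FunSym L)} {n : ℕ}
  {t : Fin n → GroundTerm L} {H : L.Sentence}

theorem realize_liftedFormula_of_forall {m : ℕ} {Fexp : L.Formula (Fin m)}
    {θ : Fin m → GroundTerm L} (hQF : BoundedFormula.IsQF Fexp) (heq : EqFree Fexp)
    (hfuns : Disjoint (funs Fexp) SG) (hent : Entails (BoundedFormula.subst Fexp θ) H)
    (hH : BoundedFormula.IsQF H) (hHeq : EqFree H)
    (hmax : ∀ s, MaxOccursIn (SF ∪ SG) s H → s ∈ Set.range t)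
    (ht : ∀ i, IsTermOf (SF ∪ SG) (t i)) (ht_inj : Function.Injective t)
    (ht_order : ∀ i j, StrictSubterm (t i) (t j) → i < j) (hdisj : Disjoint SF SG)
    {M : Type*} [L.Structure M] [Nonempty M] (hF : ∀ w : Fin m → M, Fexp.Realize w) :
    M ⊨ liftedFormula SF SG t H := by
  refine realize_prefixQuantifiers (fun i xs => termEval SG t xs (groundTerm M (t i)))
    (fun i hi => termEval_congr ht_order (hi.not_of_disjoint hdisj)) fun xs hxs => ?_
  have hco : ∀ i, xs i = termEval SG t xs (groundTerm M (t i)) := by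
    intro i
    by_cases hi : IsTermOf SF (t i)
    · exact hxs i hi
    · exact (termEval_of_isTermOf ht_inj xs ((isTermOf_union.1 (ht i)).resolve_left hi)).symm
  refine (realize_herbrand_iff_realize_invSubst Set.subset_union_right xs hco hH hHeq hmax).1 ?_
  have : Nonempty (L.Term M) := ⟨.var (Classical.arbitrary M)⟩
  let _ := herbrandStructure (termEval SG t xs)
  refine hent.realize (L.Term M) (BoundedFormula.realize_subst.2 ?_)
  exact (realize_herbrand_iff xs hQF heq hfuns _).2 (hF _)

theorem exists_realize_of_liftedFormula {m : ℕ} {Gexp : L.Formula (Fin m)}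
    {θ : Fin m → GroundTerm L} (hQF : BoundedFormula.IsQF Gexp) (heq : EqFree Gexp)
    (hfuns : Disjoint (funs Gexp) SF) (hent : Entails H (BoundedFormula.subst Gexp θ))
    (hH : BoundedFormula.IsQF H) (hHeq : EqFree H)
    (hmax : ∀ s, MaxOccursIn (SF ∪ SG) s H → s ∈ Set.range t) (ht_inj : Function.Injective t)
    (ht_order : ∀ i j, StrictSubterm (t i) (t j) → i < j)
    {M : Type*} [L.Structure M] [Nonempty M] (hM : M ⊨ liftedFormula SF SG t H) :
    ∃ w : Fin m → M, Gexp.Realize w := by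
  obtain ⟨xs, hxs, hφ⟩ := exists_realize_of_prefixQuantifiers
    (fun i xs => termEval SF t xs (groundTerm M (t i))) (fun i hi => termEval_congr ht_order hi) hM
  have hco : ∀ i, xs i = termEval SF t xs (groundTerm M (t i)) := by
    intro i
    by_cases hi : IsTermOf SF (t i)
    · exact (termEval_of_isTermOf ht_inj xs hi).symm
    · exact hxs i hi
  have hH' := (realize_herbrand_iff_realize_invSubst Set.subset_union_left xs hco hH hHeq hmax).2 hφ
  have : Nonempty (L.Term M) := ⟨.var (Classical.arbitrary M)⟩
  let _ := herbrandStructure (termEval SF t xs)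
  exact ⟨_, (realize_herbrand_iff xs hQF heq hfuns _).1
    (BoundedFormula.realize_subst.1 (hent.realize (L.Term M) hH'))⟩

end Lifting

end InterpolantLifting

theorem theorem2 {L : FirstOrder.Language.{u, v}} (F G : L.Sentence)
    (symF symG : Finset (InterpolantLifting.FunSym L)) (Hgrd : L.Sentence)
    (hbase : InterpolantLifting.IsInterpolantLiftingBase F G symF symG Hgrd)
    {n : ℕ} (t : Fin n → InterpolantLifting.GroundTerm L)
    (ht_inj : Function.Injective t)
    (ht_range : Set.range t =
      {s | InterpolantLifting.MaxOccursIn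
        ((symF : Set (InterpolantLifting.FunSym L)) ∪ (symG : Set (InterpolantLifting.FunSym L)))
        s Hgrd})
    (ht_order : ∀ i j : Fin n, InterpolantLifting.StrictSubterm (t i) (t j) → i < j) :
    InterpolantLifting.IsCraigLyndonInterpolant F G
      (InterpolantLifting.liftedFormula (symF : Set (InterpolantLifting.FunSym L))
        (symG : Set (InterpolantLifting.FunSym L)) t Hgrd) := by
  obtain ⟨m, k, Fexp, Gexp, θ, hexp⟩ := hbase.exists_expansion
  have hdisj : Disjoint (symF : Set (InterpolantLifting.FunSym L)) symG := by
    exact_mod_cast hbase.disjoint_syms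
  have hmax : ∀ s, InterpolantLifting.MaxOccursIn
      ((symF : Set (InterpolantLifting.FunSym L)) ∪ symG) s Hgrd → s ∈ Set.range t :=
    fun s hs => ht_range ▸ hs
  have ht : ∀ i, InterpolantLifting.IsTermOf
      ((symF : Set (InterpolantLifting.FunSym L)) ∪ symG) (t i) := fun i =>
    InterpolantLifting.MaxOccursIn.isTermOf (ht_range.subset (Set.mem_range_self i))
  have hFdisj : Disjoint (InterpolantLifting.funs Fexp) symG :=
    Disjoint.mono_left hexp.funs_left
      (Set.disjoint_union_left.2 ⟨hbase.disjoint_left.mono_left Set.inter_subset_left, hdisj⟩)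
  have hGdisj : Disjoint (InterpolantLifting.funs Gexp) symF :=
    Disjoint.mono_left hexp.funs_right
      (Set.disjoint_union_left.2
        ⟨hbase.disjoint_right.mono_left Set.inter_subset_right, hdisj.symm⟩)
  have hH := hexp.interpolant
  have hlift := InterpolantLifting.funs_liftedFormula_subset t hbase.ground hmax
  have hliftF := (Set.disjoint_sdiff_left.mono_left hlift).mono_right
    (Set.subset_union_left (s := (symF : Set (InterpolantLifting.FunSym L))) (t := symG))
  have hliftG := (Set.disjoint_sdiff_left.mono_left hlift).mono_right
    (Set.subset_union_right (s := (symF : Set (InterpolantLifting.FunSym L))) (t := symG))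
  have hleft : InterpolantLifting.Entails F
      (InterpolantLifting.liftedFormula symF symG t Hgrd) := by
    refine InterpolantLifting.entails_of_forall fun M _ A hF => ?_
    obtain ⟨B, hAB, hB⟩ := hexp.sem_left M A hF
    exact (hAB.realize_iff _ hliftF _ _).2
      (@InterpolantLifting.realize_liftedFormula_of_forall L symF symG n t Hgrd m Fexp _
        hexp.isQF_left hexp.eqFree_left hFdisj hH.entails_left hbase.ground hH.eqFree hmax ht
        ht_inj ht_order hdisj M B _ hB)
  have hright : InterpolantLifting.Entails
      (InterpolantLifting.liftedFormula symF symG t Hgrd) G := by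
    refine InterpolantLifting.entails_of_forall fun M _ A hM => ?_
    refine hexp.sem_right M A fun B hAB => ?_
    exact @InterpolantLifting.exists_realize_of_liftedFormula L symF symG n t Hgrd k Gexp _
      hexp.isQF_right hexp.eqFree_right hGdisj hH.entails_right hbase.ground hH.eqFree hmax
      ht_inj ht_order M B _ ((hAB.realize_iff _ hliftG _ _).1 hM)
  refine ⟨(InterpolantLifting.eqFree_liftedFormula _ _ _ _).2 hH.eqFree, ?_, hleft, hright, ?_, ?_⟩
  · exact InterpolantLifting.entails_of_forall fun M _ _ hF =>
      hright.realize M (hleft.realize M hF)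
  · intro b
    rw [InterpolantLifting.preds_liftedFormula]
    refine (hH.preds_subset b).trans ?_
    rw [InterpolantLifting.preds_subst, InterpolantLifting.preds_subst]
    exact Set.inter_subset_inter (hexp.preds_left b) (hexp.preds_right b)
  · obtain ⟨C, -, hC, hθ⟩ := hexp.funs_range
    intro f hf
    obtain ⟨hfH, hfS⟩ := hlift hf
    -- Each of the three sources below lies in `funs F ∩ funs G` up to symbols of `symF ∪ symG`,
    -- and the latter have been replaced in the lifted formula.
    have hexp_funs : f ∈ InterpolantLifting.funs Fexp ∪ InterpolantLifting.funs Gexp ∪ C := by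
      rcases InterpolantLifting.funs_subst_subset _ _ (hH.funs_subset hfH).1 with h | h
      · exact Or.inl (Or.inl h)
      · obtain ⟨i, hi⟩ := Set.mem_iUnion.1 h
        exact hθ _ hi
    rcases hexp_funs with (h | h) | h
    · exact (hexp.funs_left h).resolve_right fun h => hfS (Or.inl h)
    · exact (hexp.funs_right h).resolve_right fun h => hfS (Or.inr h)
    · exact absurd (hC f h).2 (by simpa using hfS)
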